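/- For $n\in\mathbb Z_{\ge0}$ write $(a)_n=a(a+1)\cdots(a+n-1)$ and $(a_1,\dots,a_m)_n=(a_1)_n\cdots(a_m)_n$, and let ${}_2F_1$, ${}_3F_2$ denote the usual hypergeometric series. The continuous Hahn polynomials are $$p_n(x;a,b,c,d)=i^n\,\frac{(a+c)_n(a+d)_n}{n!}\;{}_3F_2\!\left({-n,\;n+a+b+c+d-1,\;a+ix\atop a+c,\;a+d};1\right).$$ **Theorem (bilinear sum formula for continuous Hahn polynomials).** Let $a>0$ be real and let $b,d,b',d'\in\mathbb C$ have positive real parts, with $b+d=b'+d'$, $\bar d=b$ and $\bar d'=b'$. Let $x,y\in\mathbb R$ and $r\in\mathbb C$ with $|r|<1$. Then $$\sum_{j=0}^\infty h_j\,p_j(x;a,b,a,d)\,p_j(y;a,b',a,d')\,r^j={}_2F_1\!\left({a+ix,\;a+iy\atop 2a};r\right)\,{}_2F_1\!\left({d-ix,\;d'-iy\atop b+d};r\right),$$ where the series on the left converges absolutely and $$h_j=\frac{(-1)^j\,j!}{(2a,\;b+d,\;2a+b+d+j-1)_j}\;{}_2F_1\!\left({a+d+j,\;a+d'+j\atop 2a+b+d+2j};r\right).$$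 -/

import Mathlib

/-- The Pochhammer symbol `(a)_n = a (a + 1) ⋯ (a + n - 1)`. -/
noncomputable def pochhammerSymbol (a : ℂ) (n : ℕ) : ℂ :=
  (ascPochhammer ℂ n).eval a

/-- The hypergeometric series `₃F₂(a₁, a₂, a₃; b₁, b₂; z)`. -/
noncomputable def hypergeometric₃F₂ (a₁ a₂ a₃ b₁ b₂ z : ℂ) : ℂ :=
  ∑' k : ℕ,
    pochhammerSymbol a₁ k * pochhammerSymbol a₂ k * pochhammerSymbol a₃ k /
      (pochhammerSymbol b₁ k * pochhammerSymbol b₂ k * (k.factorial : ℂ)) * z ^ k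

/-- The continuous Hahn polynomial `p_n(x; a, b, c, d)`. The upper parameter `-n` makes the
`₃F₂` series a finite sum. -/
noncomputable def continuousHahn (n : ℕ) (x a b c d : ℂ) : ℂ :=
  Complex.I ^ n * (pochhammerSymbol (a + c) n * pochhammerSymbol (a + d) n / (n.factorial : ℂ)) *
    hypergeometric₃F₂ (-(n : ℂ)) ((n : ℂ) + a + b + c + d - 1) (a + Complex.I * x)
      (a + c) (a + d) 1

/-- The coefficient `h_j` of the bilinear sum formula. -/
noncomputable def bilinearHahnCoeff (a b d d' r : ℂ) (j : ℕ) : ℂ :=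
  (-1) ^ j * (j.factorial : ℂ) /
      (pochhammerSymbol (2 * a) j * pochhammerSymbol (b + d) j *
        pochhammerSymbol (2 * a + b + d + (j : ℂ) - 1) j) *
    ₂F₁ (a + d + (j : ℂ)) (a + d' + (j : ℂ)) (2 * a + b + d + 2 * (j : ℂ)) r

open Finset Polynomial

/-! Put `α = 2a`, `β = b + d`, `u = a + ix`, `v = a + iy`, `p = a + d`, `q = a + d'`, and compare
coefficients of `r ^ N`. On the right the coefficient is `∑ k, F k * G k / w k`, where `w` is the
Hahn weight and `F`, `G` are Chu-Vandermonde kernels with parameters `(u, p - u)` and `(v, q - v)`.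
The Hahn polynomials of degree at most `N` form an orthogonal basis for `w` on `{0, …, N}`, so
Parseval rewrites this as a sum over `j` of products of pairings with the `j`-th Hahn polynomial,
divided by its norm. Each pairing is a terminating `₃F₂`, hence a multiple of a continuous Hahn
polynomial (`sum_hahnPolynomial_mul_risingBinomial`). This gives
`sum_hahnSum_mul_hahnSum_div_hahnNorm`. Orthogonality comes from the same transform: the moments of
the weight are `₃F₂` values computable by finite differences.

It remains to sum over `N` first, with `j` fixed, which produces the `₂F₁` inside `h_j`
(`bilinearTerm_add`). The interchange needs an absolutely convergent double series. Since `α` and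
`β` are real, the norms are positive; for `v = conj u`, `q = conj p` the terms at degree `N` are
nonnegative and their sum is known, and the general case is dominated by two such sums
(`sum_norm_bilinearTerm_le`). -/

/-! ### Pochhammer symbols -/

theorem pochhammerSymbol_zero (a : ℂ) : pochhammerSymbol a 0 = 1 := by
  simp [pochhammerSymbol]

theorem pochhammerSymbol_succ (a : ℂ) (n : ℕ) :
    pochhammerSymbol a (n + 1) = pochhammerSymbol a n * (a + n) := by
  simp [pochhammerSymbol, ascPochhammer_succ_eval]

theorem pochhammerSymbol_add (a : ℂ) (m n : ℕ) :
    pochhammerSymbol a (m + n) = pochhammerSymbol a m * pochhammerSymbol (a + m) n := by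
  induction n with
  | zero => simp [pochhammerSymbol_zero]
  | succ n ih =>
    rw [← add_assoc, pochhammerSymbol_succ, ih, pochhammerSymbol_succ]
    push_cast
    ring

theorem pochhammerSymbol_mul_comm (a : ℂ) (m n : ℕ) :
    pochhammerSymbol a m * pochhammerSymbol (a + m) n =
      pochhammerSymbol a n * pochhammerSymbol (a + n) m := by
  rw [← pochhammerSymbol_add, ← pochhammerSymbol_add, add_comm]

theorem pochhammerSymbol_succ_left (a : ℂ) (n : ℕ) :
    pochhammerSymbol a (n + 1) = a * pochhammerSymbol (a + 1) n := by
  rw [add_comm, pochhammerSymbol_add]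
  simp [pochhammerSymbol_succ, pochhammerSymbol_zero]

theorem pochhammerSymbol_ne_zero {a : ℂ} (ha : 0 < a.re) (n : ℕ) :
    pochhammerSymbol a n ≠ 0 := by
  induction n with
  | zero => simp [pochhammerSymbol_zero]
  | succ n ih =>
    rw [pochhammerSymbol_succ]
    refine mul_ne_zero ih fun h => ?_
    have := congrArg Complex.re h
    simp at this
    have : (0 : ℝ) ≤ n := n.cast_nonneg
    linarith

theorem pochhammerSymbol_neg_natCast (j i : ℕ) :
    pochhammerSymbol (-(j : ℂ)) i = (-1) ^ i * (j.descFactorial i : ℂ) := by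
  rw [pochhammerSymbol, ascPochhammer_eval_neg_eq_descPochhammer, descPochhammer_eval_eq_descFactorial]

theorem pochhammerSymbol_neg_natCast_div_factorial (j i : ℕ) :
    pochhammerSymbol (-(j : ℂ)) i / (i.factorial : ℂ) = (-1) ^ i * (j.choose i : ℂ) := by
  rw [pochhammerSymbol_neg_natCast, Nat.descFactorial_eq_factorial_mul_choose]
  have : (i.factorial : ℂ) ≠ 0 := mod_cast i.factorial_ne_zero
  push_cast
  field_simp

/-- Reflection of the Pochhammer symbol. -/
theorem pochhammerSymbol_reflect (a : ℂ) (n : ℕ) :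
    pochhammerSymbol (1 - a - n) n = (-1) ^ n * pochhammerSymbol a n := by
  induction n with
  | zero => simp [pochhammerSymbol_zero]
  | succ n ih =>
    rw [pochhammerSymbol_succ_left, pochhammerSymbol_succ]
    have : 1 - a - ((n + 1 : ℕ) : ℂ) + 1 = 1 - a - n := by push_cast; ring
    rw [this, ih]
    push_cast
    ring

/-! ### Binomial series coefficients and Chu-Vandermonde -/

/-- The coefficient `(a)_n / n!` of the binomial series of exponent `-a`. -/
noncomputable def risingBinomial (a : ℂ) (n : ℕ) : ℂ :=
  pochhammerSymbol a n / (n.factorial : ℂ)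

theorem succ_mul_risingBinomial_succ (a : ℂ) (n : ℕ) :
    ((n : ℂ) + 1) * risingBinomial a (n + 1) = (a + n) * risingBinomial a n := by
  have : (n.factorial : ℂ) ≠ 0 := mod_cast n.factorial_ne_zero
  have h : (n : ℂ) + 1 ≠ 0 := n.cast_add_one_ne_zero
  rw [risingBinomial, risingBinomial, pochhammerSymbol_succ, Nat.factorial_succ]
  push_cast
  field_simp

theorem risingBinomial_ne_zero {a : ℂ} (ha : 0 < a.re) (n : ℕ) : risingBinomial a n ≠ 0 :=
  div_ne_zero (pochhammerSymbol_ne_zero ha n) (mod_cast n.factorial_ne_zero)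

theorem descFactorial_mul_risingBinomial (a : ℂ) (i n : ℕ) :
    ((i + n).descFactorial i : ℂ) * risingBinomial a (i + n) =
      pochhammerSymbol a i * risingBinomial (a + i) n := by
  have h : ((n.factorial : ℕ) : ℂ) * ((i + n).descFactorial i : ℂ) = ((i + n).factorial : ℂ) := by
    have := Nat.factorial_mul_descFactorial (Nat.le_add_right i n)
    rw [Nat.add_sub_cancel_left] at this
    exact_mod_cast this
  have h1 : (n.factorial : ℂ) ≠ 0 := mod_cast n.factorial_ne_zero
  have h2 : ((i + n).factorial : ℂ) ≠ 0 := mod_cast (i + n).factorial_ne_zero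
  rw [risingBinomial, risingBinomial, pochhammerSymbol_add]
  field_simp
  linear_combination pochhammerSymbol a i * pochhammerSymbol (a + i) n * h

/-- The Chu-Vandermonde convolution. -/
theorem sum_antidiagonal_risingBinomial (u w : ℂ) (n : ℕ) :
    ∑ kl ∈ antidiagonal n, risingBinomial u kl.1 * risingBinomial w kl.2 =
      risingBinomial (u + w) n := by
  induction n with
  | zero => simp [risingBinomial, pochhammerSymbol_zero]
  | succ n ih =>
    have h : (n : ℂ) + 1 ≠ 0 := n.cast_add_one_ne_zero
    apply mul_left_cancel₀ h
    rw [succ_mul_risingBinomial_succ, ← ih, mul_sum, mul_sum]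
    -- Writing `n + 1 = k + l` lets each half absorb one factor by the recurrence, as in
    -- differentiating a product of generating functions.
    have hsplit : ∀ kl ∈ antidiagonal (n + 1),
        ((n : ℂ) + 1) * (risingBinomial u kl.1 * risingBinomial w kl.2) =
          (kl.1 : ℂ) * risingBinomial u kl.1 * risingBinomial w kl.2 +
            risingBinomial u kl.1 * ((kl.2 : ℂ) * risingBinomial w kl.2) := by
      intro kl hkl
      have : (kl.1 : ℂ) + kl.2 = n + 1 := mod_cast mem_antidiagonal.mp hkl
      rw [← this]
      ring
    rw [sum_congr rfl hsplit, sum_add_distrib, Finset.Nat.sum_antidiagonal_succ,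
      Finset.Nat.sum_antidiagonal_succ' (n := n)
        (f := fun kl => risingBinomial u kl.1 * ((kl.2 : ℂ) * risingBinomial w kl.2))]
    push_cast
    simp only [succ_mul_risingBinomial_succ]
    simp only [zero_mul, mul_zero, zero_add]
    rw [← sum_add_distrib]
    refine sum_congr rfl fun kl hkl => ?_
    have : (kl.1 : ℂ) + kl.2 = n := mod_cast mem_antidiagonal.mp hkl
    rw [← this]
    ring

theorem sum_range_risingBinomial (u w : ℂ) (n : ℕ) :
    ∑ k ∈ range (n + 1), risingBinomial u k * risingBinomial w (n - k) =
      risingBinomial (u + w) n := by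
  rw [← sum_antidiagonal_risingBinomial,
    Finset.Nat.sum_antidiagonal_eq_sum_range_succ fun k l => risingBinomial u k * risingBinomial w l]

/-- Factorial moments of the Chu-Vandermonde convolution. -/
theorem sum_range_descFactorial_risingBinomial (u w : ℂ) {i n : ℕ} (hi : i ≤ n) :
    ∑ k ∈ range (n + 1), (k.descFactorial i : ℂ) * (risingBinomial u k * risingBinomial w (n - k)) =
      pochhammerSymbol u i * risingBinomial (u + w + i) (n - i) := by
  obtain ⟨m, rfl⟩ := Nat.exists_eq_add_of_le hi
  rw [add_assoc, sum_range_add, sum_eq_zero, zero_add, Nat.add_sub_cancel_left,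
    add_right_comm, ← sum_range_risingBinomial, mul_sum]
  · refine sum_congr rfl fun k hk => ?_
    rw [← mul_assoc, descFactorial_mul_risingBinomial, Nat.add_sub_add_left, mul_assoc]
  · intro k hk
    rw [Nat.descFactorial_of_lt (mem_range.mp hk)]
    simp

/-! ### Finite differences -/

/-- The alternating binomial sum of a polynomial of degree `< j` vanishes. -/
theorem sum_alternating_choose_mul_eval_eq_zero {P : ℂ[X]} {j : ℕ} (hP : P.natDegree < j) :
    ∑ i ∈ range (j + 1), (-1 : ℂ) ^ i * (j.choose i : ℂ) * P.eval (i : ℂ) = 0 := by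
  have h := congrFun (Polynomial.fwdDiff_iter_eq_zero_of_degree_lt hP) 0
  rw [fwdDiff_iter_eq_sum_shift] at h
  have h2 : (-1 : ℂ) ^ j * ∑ i ∈ range (j + 1),
      ((-1 : ℤ) ^ (j - i) * (j.choose i : ℤ)) • P.eval (0 + i • (1 : ℂ)) = 0 := by
    rw [h]; simp
  rw [← h2, mul_sum]
  refine sum_congr rfl fun i hi => ?_
  obtain ⟨m, rfl⟩ := Nat.exists_eq_add_of_le (mem_range_succ_iff.mp hi)
  have hm : ((-1 : ℂ) ^ m) * (-1) ^ m = 1 := by rw [← mul_pow]; simp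
  rw [Nat.add_sub_cancel_left, pow_add]
  simp only [zsmul_eq_mul, nsmul_eq_mul, mul_one, zero_add]
  push_cast
  linear_combination (-(-1 : ℂ) ^ i * ((i + m).choose i : ℂ) * P.eval (i : ℂ)) * hm

/-- The alternating binomial sum of `1 / (c + i)`. -/
theorem sum_alternating_choose_div {c : ℂ} (hc : 0 < c.re) (j : ℕ) :
    ∑ i ∈ range (j + 1), (-1 : ℂ) ^ i * (j.choose i : ℂ) / (c + i) =
      (j.factorial : ℂ) / pochhammerSymbol c (j + 1) := by
  induction j generalizing c with
  | zero => simp [pochhammerSymbol_succ, pochhammerSymbol_zero]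
  | succ j ih =>
    have hc1 : 0 < (c + 1).re := by simp; linarith
    -- Pascal's rule: a difference of order `j + 1` is a difference of two differences of order `j`,
    -- at `c` and `c + 1`.
    have hrec : ∑ i ∈ range (j + 1 + 1), (-1 : ℂ) ^ i * ((j + 1).choose i : ℂ) / (c + i) =
        ∑ i ∈ range (j + 1), (-1 : ℂ) ^ i * (j.choose i : ℂ) / (c + i) -
        ∑ i ∈ range (j + 1), (-1 : ℂ) ^ i * (j.choose i : ℂ) / (c + 1 + i) := by
      rw [sum_range_succ' _ (j + 1)]
      have : ∑ i ∈ range (j + 1), (-1 : ℂ) ^ i * (j.choose i : ℂ) / (c + i) =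
          ∑ i ∈ range (j + 1), (-1 : ℂ) ^ (i + 1) * (j.choose (i + 1) : ℂ) / (c + (i + 1 : ℕ)) +
            1 / c := by
        rw [sum_range_succ' _ j, sum_range_succ _ j, Nat.choose_succ_self]
        simp
      rw [this, add_sub_right_comm, ← sum_sub_distrib]
      congr 1
      · refine sum_congr rfl fun i _ => ?_
        rw [Nat.choose_succ_succ, pow_succ]
        push_cast
        rw [add_assoc c 1, add_comm 1 (i : ℂ)]
        ring
      · simp
    rw [hrec, ih hc, ih hc1]
    have h1 := pochhammerSymbol_ne_zero hc (j + 1 + 1)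
    have h2 := pochhammerSymbol_ne_zero hc1 (j + 1)
    have e1 := pochhammerSymbol_succ c (j + 1)
    have e2 := pochhammerSymbol_succ_left c (j + 1)
    have h3 := pochhammerSymbol_ne_zero hc (j + 1)
    have hc0 : c ≠ 0 := by rintro rfl; simp at hc
    have hcj : c + ((j + 1 : ℕ) : ℂ) ≠ 0 := by
      intro h; rw [e1, h, mul_zero] at h1; exact h1 rfl
    have e3 : pochhammerSymbol (c + 1) (j + 1) =
        pochhammerSymbol c (j + 1) * (c + ((j + 1 : ℕ) : ℂ)) / c := by
      rw [eq_div_iff hc0, ← e1, e2]; ring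
    rw [e1, e3, Nat.factorial_succ]
    field_simp
    push_cast
    ring

/-- Divide `P` by `X + c`: the quotient has degree below `j`, so its `j`-th difference vanishes, and
the remainder `P(-c)` multiplies the sum of `1 / (c + i)`. -/
theorem sum_alternating_choose_eval_div {c : ℂ} (hc : 0 < c.re) {j : ℕ} {P : ℂ[X]}
    (hP : P.natDegree ≤ j) :
    ∑ i ∈ range (j + 1), (-1 : ℂ) ^ i * (j.choose i : ℂ) * (P.eval (i : ℂ) / (c + i)) =
      P.eval (-c) * (j.factorial : ℂ) / pochhammerSymbol c (j + 1) := by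
  have hden : ∀ i : ℕ, c + i ≠ 0 := by
    intro i h
    have := congrArg Complex.re h
    simp at this
    have : (0 : ℝ) ≤ i := i.cast_nonneg
    linarith
  set R := P /ₘ (X - C (-c)) with hR
  have hdiv : ∀ z, P.eval z = (z + c) * R.eval z + P.eval (-c) := by
    intro z
    have := congrArg (Polynomial.eval z) (modByMonic_add_div P (X - C (-c)))
    rw [modByMonic_X_sub_C_eq_C_eval, ← hR] at this
    simp only [eval_add, eval_mul, eval_sub, eval_X, eval_C] at this
    linear_combination -this
  have hsum : ∀ i ∈ range (j + 1), (-1 : ℂ) ^ i * (j.choose i : ℂ) * (P.eval (i : ℂ) / (c + i)) =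
      (-1 : ℂ) ^ i * (j.choose i : ℂ) * R.eval (i : ℂ) +
        P.eval (-c) * ((-1 : ℂ) ^ i * (j.choose i : ℂ) / (c + i)) := by
    intro i _
    have := hden i
    rw [hdiv i]
    field_simp
    ring
  rw [sum_congr rfl hsum, sum_add_distrib, ← mul_sum, sum_alternating_choose_div hc, mul_div_assoc]
  rw [add_eq_right]
  by_cases hj : j = 0
  · subst hj
    have : R = 0 := by
      rw [hR, divByMonic_eq_zero_iff (monic_X_sub_C _), degree_X_sub_C]
      exact lt_of_le_of_lt degree_le_natDegree (by simp [Nat.le_zero.mp hP])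
    simp [this]
  · apply sum_alternating_choose_mul_eval_eq_zero
    rw [hR, natDegree_divByMonic _ (monic_X_sub_C _), natDegree_X_sub_C]
    omega

/-! ### Hahn polynomials and their transform -/

/-- The coefficients `(-j)_i (j + s - 1)_i / ((α)_i i!)` shared by the Hahn polynomials and the
continuous Hahn polynomials. -/
noncomputable def hahnCoeff (α s : ℂ) (j i : ℕ) : ℂ :=
  pochhammerSymbol (-(j : ℂ)) i * pochhammerSymbol (j + s - 1) i /
    (pochhammerSymbol α i * (i.factorial : ℂ))

/-- The terminating series `₃F₂(-j, j + s - 1, u; α, p; 1)`. -/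
noncomputable def hahnSum (α s : ℂ) (j : ℕ) (u p : ℂ) : ℂ :=
  ∑ i ∈ range (j + 1), hahnCoeff α s j i * (pochhammerSymbol u i / pochhammerSymbol p i)

/-- The Hahn polynomial `₃F₂(-j, j + s - 1, -X; α, -N; 1)`. -/
noncomputable def hahnPolynomial (α s : ℂ) (N j : ℕ) : ℂ[X] :=
  ∑ i ∈ range (j + 1), C (hahnCoeff α s j i / (N.descFactorial i : ℂ)) * descPochhammer ℂ i

theorem hahnPolynomial_eval_natCast (α s : ℂ) (N j k : ℕ) :
    (hahnPolynomial α s N j).eval (k : ℂ) =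
      ∑ i ∈ range (j + 1), hahnCoeff α s j i / (N.descFactorial i : ℂ) *
        (k.descFactorial i : ℂ) := by
  simp [hahnPolynomial, eval_finsetSum, descPochhammer_eval_eq_descFactorial]

theorem natDegree_hahnPolynomial_le (α s : ℂ) (N j : ℕ) :
    (hahnPolynomial α s N j).natDegree ≤ j := by
  refine natDegree_sum_le_of_forall_le _ _ fun i hi => ?_
  refine (natDegree_C_mul_le _ _).trans ?_
  rw [descPochhammer_natDegree]
  exact mem_range_succ_iff.mp hi

theorem coeff_hahnPolynomial_self (α s : ℂ) (N j : ℕ) :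
    (hahnPolynomial α s N j).coeff j = hahnCoeff α s j j / (N.descFactorial j : ℂ) := by
  rw [hahnPolynomial, finsetSum_coeff, sum_range_succ, sum_eq_zero, zero_add, coeff_C_mul]
  · have := (monic_descPochhammer ℂ j).coeff_natDegree
    rw [descPochhammer_natDegree] at this
    rw [this, mul_one]
  · intro i hi
    rw [coeff_C_mul, coeff_eq_zero_of_natDegree_lt, mul_zero]
    rw [descPochhammer_natDegree]
    exact mem_range.mp hi

/-- The Hahn polynomials are transformed into continuous Hahn polynomials by the kernel of the
Chu-Vandermonde convolution. -/
theorem sum_hahnPolynomial_mul_risingBinomial (α s u : ℂ) {p : ℂ} (hp : 0 < p.re) {N j : ℕ}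
    (hj : j ≤ N) :
    ∑ k ∈ range (N + 1), (hahnPolynomial α s N j).eval (k : ℂ) *
        (risingBinomial u k * risingBinomial (p - u) (N - k)) =
      risingBinomial p N * hahnSum α s j u p := by
  simp_rw [hahnPolynomial_eval_natCast, sum_mul]
  rw [sum_comm, hahnSum, mul_sum]
  refine sum_congr rfl fun i hi => ?_
  have hi' : i ≤ N := (mem_range_succ_iff.mp hi).trans hj
  simp_rw [mul_assoc]
  rw [← mul_sum, sum_range_descFactorial_risingBinomial _ _ hi', add_sub_cancel]
  obtain ⟨n, rfl⟩ := Nat.exists_eq_add_of_le hi'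
  rw [Nat.add_sub_cancel_left]
  have h := descFactorial_mul_risingBinomial p i n
  have h1 : ((i + n).descFactorial i : ℂ) ≠ 0 := by
    rw [Nat.cast_ne_zero, Ne, Nat.descFactorial_eq_zero_iff_lt]; omega
  have h2 := pochhammerSymbol_ne_zero hp i
  field_simp
  linear_combination -(hahnCoeff α s j i * pochhammerSymbol u i) * h

/-- Exhibits the series as a `j`-th finite difference, so it can be evaluated whenever the remaining
ratios are polynomial, or nearly so, in `i`. -/
theorem hahnSum_eq_sum_choose (α s : ℂ) (j : ℕ) (u p : ℂ) :
    hahnSum α s j u p = ∑ i ∈ range (j + 1), (-1 : ℂ) ^ i * (j.choose i : ℂ) *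
      (pochhammerSymbol (j + s - 1) i / pochhammerSymbol p i *
        (pochhammerSymbol u i / pochhammerSymbol α i)) := by
  refine sum_congr rfl fun i _ => ?_
  rw [← pochhammerSymbol_neg_natCast_div_factorial, hahnCoeff]
  field_simp

/-! ### Evaluation of the `₃F₂` at shifted parameters -/

/-- The polynomial `z ↦ (a + z)_m`. -/
noncomputable def shiftedPochhammer (a : ℂ) (m : ℕ) : ℂ[X] :=
  (ascPochhammer ℂ m).comp (X + C a)

theorem shiftedPochhammer_eval (a z : ℂ) (m : ℕ) :
    (shiftedPochhammer a m).eval z = pochhammerSymbol (a + z) m := by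
  simp [shiftedPochhammer, pochhammerSymbol, add_comm]

theorem natDegree_shiftedPochhammer (a : ℂ) (m : ℕ) : (shiftedPochhammer a m).natDegree = m := by
  rw [shiftedPochhammer, natDegree_comp, ascPochhammer_natDegree, natDegree_X_add_C, mul_one]

theorem monic_shiftedPochhammer (a : ℂ) (m : ℕ) : (shiftedPochhammer a m).Monic :=
  (monic_ascPochhammer ℂ m).comp_X_add_C a

theorem pochhammerSymbol_div_shift {a : ℂ} (ha : 0 < a.re) (m i : ℕ) :
    pochhammerSymbol (a + m) i / pochhammerSymbol a i =
      pochhammerSymbol (a + i) m / pochhammerSymbol a m := by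
  rw [div_eq_div_iff (pochhammerSymbol_ne_zero ha i) (pochhammerSymbol_ne_zero ha m)]
  linear_combination pochhammerSymbol_mul_comm a m i

/-- With `j = m + n + 1`, the two Pochhammer ratios are polynomials in `i` of degrees `n` and `m`;
the total degree `j - 1` is killed by a `j`-th difference. -/
theorem hahnSum_shift_eq_zero {α s : ℂ} (hα : 0 < α.re) (hs : 0 < s.re) {m j : ℕ} (hm : m < j) :
    hahnSum α s j (α + m) (s + m) = 0 := by
  obtain ⟨n, rfl⟩ := Nat.exists_eq_add_of_lt hm
  have hsm : 0 < (s + m).re := by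
    simp only [Complex.add_re, Complex.natCast_re]; positivity
  rw [hahnSum_eq_sum_choose]
  have e : ((m + n + 1 : ℕ) : ℂ) + s - 1 = s + m + n := by push_cast; ring
  have hdiv := pochhammerSymbol_div_shift hsm n
  rw [e]
  have key := sum_alternating_choose_mul_eval_eq_zero (j := m + n + 1)
    (P := C (pochhammerSymbol (s + m) n * pochhammerSymbol α m)⁻¹ *
      (shiftedPochhammer (s + m) n * shiftedPochhammer α m)) (by
        refine lt_of_le_of_lt ((natDegree_C_mul_le _ _).trans natDegree_mul_le) ?_
        rw [natDegree_shiftedPochhammer, natDegree_shiftedPochhammer]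
        omega)
  rw [← key]
  refine sum_congr rfl fun i _ => ?_
  rw [hdiv i, pochhammerSymbol_div_shift hα, eval_mul, eval_mul, eval_C, shiftedPochhammer_eval,
    shiftedPochhammer_eval, mul_inv]
  ring

/-- One shift further, a ratio becomes `c / (c + i)` with `c = j + α + β - 1`, so the sum has the
form treated in `sum_alternating_choose_eval_div`. -/
theorem hahnSum_shift_self {α β : ℂ} (hα : 0 < α.re) (hβ : 0 < β.re) (j : ℕ) :
    hahnSum α (α + β) j (α + j) (α + β + j) =
      (-1) ^ j * pochhammerSymbol β j * (j.factorial : ℂ) /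
        (pochhammerSymbol α j * pochhammerSymbol (α + β + j) j) := by
  -- For `j = 0` the number `c` may fail to have positive real part.
  rcases j with _ | n
  · simp [hahnSum, hahnCoeff, pochhammerSymbol_zero]
  set j := n + 1 with hj
  set c : ℂ := j + (α + β) - 1 with hc
  have hcn : c = α + β + n := by rw [hc, hj]; push_cast; ring
  have hcre : 0 < c.re := by
    rw [hcn]; simp only [Complex.add_re, Complex.natCast_re]; positivity
  have hc1 : α + β + j = c + 1 := by rw [hc]; ring
  have hc0 : c ≠ 0 := by intro h; simp [h] at hcre
  have hc1re : 0 < (c + 1).re := by simp; linarith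
  -- The value at `-c` is `(1 - β - j)_j`, which reflection turns into `(-1)^j (β)_j`.
  have hαc : α + -c = 1 - β - j := by rw [hc]; ring
  have hratio : ∀ i : ℕ, pochhammerSymbol c i / pochhammerSymbol (c + 1) i = c / (c + i) := by
    intro i
    have hci : c + i ≠ 0 := by
      intro h
      have := pochhammerSymbol_succ c i
      rw [h, mul_zero] at this
      exact pochhammerSymbol_ne_zero hcre _ this
    rw [div_eq_div_iff (pochhammerSymbol_ne_zero hc1re i) hci, ← pochhammerSymbol_succ,
      pochhammerSymbol_succ_left]
  rw [hahnSum_eq_sum_choose, hc1, ← hc]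
  have key := sum_alternating_choose_eval_div hcre (P := shiftedPochhammer α j)
    (natDegree_shiftedPochhammer α j).le
  rw [shiftedPochhammer_eval, hαc, pochhammerSymbol_reflect, pochhammerSymbol_succ_left c] at key
  have hαj := pochhammerSymbol_ne_zero hα j
  have hcj := pochhammerSymbol_ne_zero hc1re j
  rw [← mul_right_inj' hαj, ← mul_left_inj' (inv_ne_zero hc0), mul_sum, sum_mul]
  trans (-1) ^ j * pochhammerSymbol β j * (j.factorial : ℂ) / (c * pochhammerSymbol (c + 1) j)
  · rw [← key]
    refine sum_congr rfl fun i _ => ?_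
    rw [shiftedPochhammer_eval, pochhammerSymbol_div_shift hα, hratio]
    field_simp
  · field_simp

/-! ### Orthogonality and dual orthogonality -/

/-- The Hahn weight. -/
noncomputable def hahnWeight (α β : ℂ) (N k : ℕ) : ℂ :=
  risingBinomial α k * risingBinomial β (N - k)

/-- Since `(α)_k (α + k)_m = (α)_m (α + m)_k`, the extra factor only shifts `α` to `α + m` in the
weight, which is then a Chu-Vandermonde kernel. -/
theorem sum_hahnWeight_mul_shiftedPochhammer {α β : ℂ} (hα : 0 < α.re) (hβ : 0 < β.re)
    {N j : ℕ} (hj : j ≤ N) (m : ℕ) :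
    ∑ k ∈ range (N + 1), hahnWeight α β N k * (hahnPolynomial α (α + β) N j).eval (k : ℂ) *
        (shiftedPochhammer α m).eval (k : ℂ) =
      pochhammerSymbol α m * risingBinomial (α + β + m) N *
        hahnSum α (α + β) j (α + m) (α + β + m) := by
  have hsm : 0 < (α + β + m).re := by
    simp only [Complex.add_re, Complex.natCast_re]; positivity
  have h := sum_hahnPolynomial_mul_risingBinomial α (α + β) (α + m) hsm hj
  rw [mul_assoc, ← h, mul_sum]
  refine sum_congr rfl fun k _ => ?_
  have hmk := pochhammerSymbol_mul_comm α m k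
  have hβ' : α + β + m - (α + m) = β := by ring
  rw [hβ', shiftedPochhammer_eval, hahnWeight, risingBinomial.eq_1 α, risingBinomial.eq_1 (α + m)]
  linear_combination (-1 / (k.factorial : ℂ) * risingBinomial β (N - k) *
    (hahnPolynomial α (α + β) N j).eval (k : ℂ)) * hmk

/-- The squared norm of the Hahn polynomial of degree `j` (without conjugation). -/
noncomputable def hahnNorm (α β : ℂ) (N j : ℕ) : ℂ :=
  pochhammerSymbol (α + β + j) N / (N.factorial : ℂ) * pochhammerSymbol β j * (j.factorial : ℂ) *
    pochhammerSymbol (j + (α + β) - 1) j /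
      (pochhammerSymbol (α + β + j) j * pochhammerSymbol α j * (N.descFactorial j : ℂ))

/-- The polynomials `(α + z)_m` form a monic basis whose pairings vanish for `m < j`, so only the
coefficient of degree `j` survives. -/
theorem sum_hahnWeight_mul_eval {α β : ℂ} (hα : 0 < α.re) (hβ : 0 < β.re) {N j : ℕ} (hj : j ≤ N) :
    ∀ n ≤ j, ∀ P : ℂ[X], P.natDegree ≤ n →
    ∑ k ∈ range (N + 1), hahnWeight α β N k * (hahnPolynomial α (α + β) N j).eval (k : ℂ) *
        P.eval (k : ℂ) =
      P.coeff j * (pochhammerSymbol α j * risingBinomial (α + β + j) N *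
        hahnSum α (α + β) j (α + j) (α + β + j)) := by
  intro n
  induction n with
  | zero =>
    intro _ P hP
    have h := sum_hahnWeight_mul_shiftedPochhammer hα hβ hj 0
    rw [eq_C_of_natDegree_le_zero hP]
    simp only [shiftedPochhammer, ascPochhammer_zero, one_comp, eval_one, mul_one] at h
    simp only [eval_C]
    rw [← sum_mul, h]
    rcases Nat.eq_zero_or_pos j with rfl | hpos
    · simp [mul_comm]
    · rw [hahnSum_shift_eq_zero hα (by simp; positivity) hpos, coeff_C, if_neg hpos.ne']
      ring
  | succ n ih =>
    intro hn P hP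
    set c := P.coeff (n + 1) with hc
    set S := shiftedPochhammer α (n + 1) with hS
    have hSdeg : S.natDegree = n + 1 := natDegree_shiftedPochhammer _ _
    have hScoeff : S.coeff (n + 1) = 1 := by
      have := (monic_shiftedPochhammer α (n + 1)).coeff_natDegree
      rwa [natDegree_shiftedPochhammer] at this
    have hdeg : (P - C c * S).natDegree ≤ n := by
      rw [natDegree_le_iff_coeff_eq_zero]
      intro m hm
      rcases Nat.lt_or_eq_of_le (Nat.succ_le_of_lt hm) with h | h
      · rw [coeff_sub, coeff_C_mul, coeff_eq_zero_of_natDegree_lt (lt_of_le_of_lt hP h),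
          coeff_eq_zero_of_natDegree_lt (lt_of_le_of_lt hSdeg.le h)]
        ring
      · rw [coeff_sub, coeff_C_mul, ← h, Nat.succ_eq_add_one, hScoeff, hc]
        ring
    have h1 := ih (by omega) _ hdeg
    have h2 := sum_hahnWeight_mul_shiftedPochhammer hα hβ hj (n + 1)
    rw [← hS] at h2
    have hsplit : ∀ z, P.eval z = (P - C c * S).eval z + c * S.eval z := by intro z; simp
    simp_rw [hsplit, mul_add, sum_add_distrib]
    rw [h1, coeff_sub, coeff_C_mul, sub_mul]
    have h3 : ∑ k ∈ range (N + 1), hahnWeight α β N k *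
        (hahnPolynomial α (α + β) N j).eval (k : ℂ) * (c * S.eval (k : ℂ)) =
        c * S.coeff j * (pochhammerSymbol α j * risingBinomial (α + β + j) N *
          hahnSum α (α + β) j (α + j) (α + β + j)) := by
      have : ∀ k : ℕ, hahnWeight α β N k * (hahnPolynomial α (α + β) N j).eval (k : ℂ) *
          (c * S.eval (k : ℂ)) = c * (hahnWeight α β N k *
            (hahnPolynomial α (α + β) N j).eval (k : ℂ) * S.eval (k : ℂ)) := by intro k; ring
      simp_rw [this]
      rw [← mul_sum, h2]
      rcases Nat.lt_or_eq_of_le hn with hlt | rfl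
      · rw [hahnSum_shift_eq_zero hα (by simp; positivity) hlt,
          coeff_eq_zero_of_natDegree_lt (lt_of_le_of_lt hSdeg.le hlt)]
        ring
      · rw [hScoeff]; ring
    rw [h3]
    ring

theorem pochhammerSymbol_natCast_add_sub_one_ne_zero {s : ℂ} (hs : 0 < s.re) (j : ℕ) :
    pochhammerSymbol (j + s - 1) j ≠ 0 := by
  rcases j with _ | n
  · simp [pochhammerSymbol_zero]
  · apply pochhammerSymbol_ne_zero
    have : ((n + 1 : ℕ) : ℂ) + s - 1 = n + s := by push_cast; ring
    rw [this, Complex.add_re, Complex.natCast_re]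
    positivity

theorem hahnCoeff_self {α s : ℂ} (j : ℕ) :
    hahnCoeff α s j j = (-1) ^ j * pochhammerSymbol (j + s - 1) j / pochhammerSymbol α j := by
  have h := pochhammerSymbol_neg_natCast_div_factorial j j
  rw [Nat.choose_self, Nat.cast_one, mul_one] at h
  rw [← h, hahnCoeff]
  field_simp

/-- Orthogonality of the Hahn polynomials. -/
theorem sum_hahnWeight_mul_hahnPolynomial {α β : ℂ} (hα : 0 < α.re) (hβ : 0 < β.re) {N i j : ℕ}
    (hi : i ≤ N) (hj : j ≤ N) :
    ∑ k ∈ range (N + 1), hahnWeight α β N k * (hahnPolynomial α (α + β) N j).eval (k : ℂ) *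
        (hahnPolynomial α (α + β) N i).eval (k : ℂ) = if i = j then hahnNorm α β N j else 0 := by
  have lt : ∀ {i j : ℕ}, j ≤ N → i < j → ∑ k ∈ range (N + 1), hahnWeight α β N k *
      (hahnPolynomial α (α + β) N j).eval (k : ℂ) *
        (hahnPolynomial α (α + β) N i).eval (k : ℂ) = 0 := by
    intro i j hj hij
    have hd := natDegree_hahnPolynomial_le α (α + β) N i
    rw [sum_hahnWeight_mul_eval hα hβ hj j le_rfl _ (hd.trans hij.le),
      coeff_eq_zero_of_natDegree_lt (lt_of_le_of_lt hd hij), zero_mul]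
  rcases lt_trichotomy i j with h | rfl | h
  · rw [lt hj h, if_neg h.ne]
  · rw [if_pos rfl, sum_hahnWeight_mul_eval hα hβ hj i le_rfl _
      (natDegree_hahnPolynomial_le _ _ _ _), coeff_hahnPolynomial_self, hahnCoeff_self,
      hahnSum_shift_self hα hβ, hahnNorm, risingBinomial]
    have h1 := pochhammerSymbol_ne_zero hα i
    have hm : ((-1 : ℂ) ^ i) ^ 2 = 1 := by rw [← pow_mul, mul_comm, pow_mul]; simp
    field_simp
    rw [hm, one_mul]
  · rw [if_neg h.ne', ← lt hi h]
    refine sum_congr rfl fun k _ => by ring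

theorem hahnNorm_ne_zero {α β : ℂ} (hα : 0 < α.re) (hβ : 0 < β.re) {N j : ℕ} (hj : j ≤ N) :
    hahnNorm α β N j ≠ 0 := by
  have hs : 0 < (α + β).re := by simp; positivity
  have hsj : 0 < (α + β + j).re := by
    simp only [Complex.add_re, Complex.natCast_re]; positivity
  have h1 : (N.descFactorial j : ℂ) ≠ 0 := by
    rw [Nat.cast_ne_zero, Ne, Nat.descFactorial_eq_zero_iff_lt]; omega
  have h2 := pochhammerSymbol_ne_zero hα j
  have h3 := pochhammerSymbol_ne_zero hβ j
  have h4 := pochhammerSymbol_ne_zero hsj j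
  have h5 := pochhammerSymbol_ne_zero hsj N
  have h6 := pochhammerSymbol_natCast_add_sub_one_ne_zero hs j
  have h7 : (N.factorial : ℂ) ≠ 0 := mod_cast N.factorial_ne_zero
  have h8 : (j.factorial : ℂ) ≠ 0 := mod_cast j.factorial_ne_zero
  rw [hahnNorm]
  simp [*]

/-- Dual orthogonality of the Hahn polynomials. -/
theorem sum_hahnPolynomial_mul_hahnPolynomial_div_hahnNorm {α β : ℂ} (hα : 0 < α.re)
    (hβ : 0 < β.re) {N k l : ℕ} (hk : k ≤ N) (hl : l ≤ N) :
    ∑ j ∈ range (N + 1), (hahnPolynomial α (α + β) N j).eval (k : ℂ) *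
        (hahnPolynomial α (α + β) N j).eval (l : ℂ) / hahnNorm α β N j =
      if k = l then (hahnWeight α β N k)⁻¹ else 0 := by
  have hw : ∀ k, hahnWeight α β N k ≠ 0 := fun k =>
    mul_ne_zero (risingBinomial_ne_zero hα _) (risingBinomial_ne_zero hβ _)
  let A : Matrix (Fin (N + 1)) (Fin (N + 1)) ℂ := fun j k =>
    hahnWeight α β N k * (hahnPolynomial α (α + β) N j).eval ((k : ℕ) : ℂ)
  let B : Matrix (Fin (N + 1)) (Fin (N + 1)) ℂ := fun k j =>
    (hahnPolynomial α (α + β) N j).eval ((k : ℕ) : ℂ) / hahnNorm α β N j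
  have hAB : A * B = 1 := by
    ext j i
    have hi : (i : ℕ) ≤ N := by omega
    rw [Matrix.mul_apply, Matrix.one_apply]
    have h := sum_hahnWeight_mul_hahnPolynomial hα hβ hi (show (j : ℕ) ≤ N by omega)
    rw [← Fin.sum_univ_eq_sum_range fun k : ℕ => hahnWeight α β N k *
      (hahnPolynomial α (α + β) N j).eval (k : ℂ) *
        (hahnPolynomial α (α + β) N i).eval (k : ℂ)] at h
    simp only [A, B, ← mul_div_assoc]
    rw [← sum_div, h]
    by_cases hij : j = i
    · subst hij
      simp [hahnNorm_ne_zero hα hβ hi]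
    · rw [if_neg hij, if_neg (fun h => hij (Fin.ext h.symm)), zero_div]
  -- Orthogonality says `A * B = 1`; for square matrices `B * A = 1` follows, and this is the dual
  -- relation.
  have hBA := mul_eq_one_comm.mp hAB
  have h := congrFun (congrFun hBA ⟨k, by omega⟩) ⟨l, by omega⟩
  rw [Matrix.mul_apply, Matrix.one_apply] at h
  simp only [A, B, Fin.mk.injEq] at h
  rw [Fin.sum_univ_eq_sum_range fun j : ℕ => (hahnPolynomial α (α + β) N j).eval (k : ℂ) /
    hahnNorm α β N j * (hahnWeight α β N l * (hahnPolynomial α (α + β) N j).eval (l : ℂ))] at h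
  have hwl := hw l
  rw [← mul_right_inj' hwl, mul_sum]
  trans if k = l then 1 else 0
  · rw [← h]
    refine sum_congr rfl fun j _ => by ring
  · split_ifs with hkl
    · rw [hkl, mul_inv_cancel₀ hwl]
    · rw [mul_zero]

/-! ### Parseval at a fixed degree -/

/-- The bilinear sum of continuous Hahn polynomials at a fixed degree in `r`. -/
theorem sum_hahnSum_mul_hahnSum_div_hahnNorm {α β : ℂ} (hα : 0 < α.re) (hβ : 0 < β.re)
    {p q : ℂ} (hp : 0 < p.re) (hq : 0 < q.re) (u v : ℂ) (N : ℕ) :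
    ∑ j ∈ range (N + 1), risingBinomial p N * risingBinomial q N / hahnNorm α β N j *
        (hahnSum α (α + β) j u p * hahnSum α (α + β) j v q) =
      ∑ k ∈ range (N + 1), risingBinomial u k * risingBinomial v k / risingBinomial α k *
        (risingBinomial (p - u) (N - k) * risingBinomial (q - v) (N - k) /
          risingBinomial β (N - k)) := by
  set F : ℕ → ℂ := fun k => risingBinomial u k * risingBinomial (p - u) (N - k) with hF
  set G : ℕ → ℂ := fun k => risingBinomial v k * risingBinomial (q - v) (N - k) with hG
  set Q : ℕ → ℕ → ℂ := fun j k => (hahnPolynomial α (α + β) N j).eval (k : ℂ) with hQ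
  trans ∑ j ∈ range (N + 1), ∑ k ∈ range (N + 1), ∑ l ∈ range (N + 1),
      F k * G l * (Q j k * Q j l / hahnNorm α β N j)
  · refine sum_congr rfl fun j hj => ?_
    have hj' := mem_range_succ_iff.mp hj
    have e1 := sum_hahnPolynomial_mul_risingBinomial α (α + β) u hp hj'
    have e2 := sum_hahnPolynomial_mul_risingBinomial α (α + β) v hq hj'
    trans (∑ k ∈ range (N + 1), Q j k * F k) * (∑ l ∈ range (N + 1), Q j l * G l) /
      hahnNorm α β N j
    · rw [e1, e2]; ring
    · rw [sum_mul_sum, sum_div]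
      refine sum_congr rfl fun k _ => ?_
      rw [sum_div]
      exact sum_congr rfl fun l _ => by ring
  · rw [sum_comm]
    refine sum_congr rfl fun k hk => ?_
    rw [sum_comm]
    trans ∑ l ∈ range (N + 1), F k * G l * (if k = l then (hahnWeight α β N k)⁻¹ else 0)
    · refine sum_congr rfl fun l hl => ?_
      rw [← mul_sum, sum_hahnPolynomial_mul_hahnPolynomial_div_hahnNorm hα hβ
        (mem_range_succ_iff.mp hk) (mem_range_succ_iff.mp hl)]
    · simp_rw [mul_ite, mul_zero]
      rw [sum_ite_eq, if_pos hk, hahnWeight, hF, hG]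
      field_simp

/-! ### Gauss series -/

/-- The coefficient of the hypergeometric series `₂F₁(a, b; c; r)`. -/
noncomputable def gaussCoeff (a b c : ℂ) (n : ℕ) : ℂ :=
  risingBinomial a n * risingBinomial b n / risingBinomial c n

theorem gaussCoeff_mul_pow (a b c r : ℂ) (n : ℕ) :
    gaussCoeff a b c n * r ^ n = ordinaryHypergeometricSeries ℂ a b c n fun _ => r := by
  rw [ordinaryHypergeometricSeries_apply_eq, gaussCoeff, risingBinomial, risingBinomial,
    risingBinomial, smul_eq_mul]
  have : (n.factorial : ℂ) ≠ 0 := mod_cast n.factorial_ne_zero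
  simp only [pochhammerSymbol]
  field_simp

theorem summable_norm_gaussCoeff_mul_pow {a b c r : ℂ} (ha : 0 < a.re) (hb : 0 < b.re)
    (hc : 0 < c.re) (hr : ‖r‖ < 1) : Summable fun n => ‖gaussCoeff a b c n * r ^ n‖ := by
  have hne : ∀ {z : ℂ}, 0 < z.re → ∀ k : ℕ, (k : ℂ) ≠ -z := by
    intro z hz k h
    have := congrArg Complex.re h
    simp only [Complex.natCast_re, Complex.neg_re] at this
    have : (0 : ℝ) ≤ k := k.cast_nonneg
    linarith
  simp_rw [gaussCoeff_mul_pow]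
  apply FormalMultilinearSeries.summable_norm_apply
  rw [ordinaryHypergeometricSeries_radius_eq_one ℂ a b c
    fun k => ⟨hne ha k, hne hb k, hne hc k⟩]
  simpa [enorm_eq_nnnorm, ← NNReal.coe_lt_coe] using hr

theorem hasSum_gaussCoeff_mul_pow {a b c r : ℂ} (ha : 0 < a.re) (hb : 0 < b.re)
    (hc : 0 < c.re) (hr : ‖r‖ < 1) :
    HasSum (fun n => gaussCoeff a b c n * r ^ n) (₂F₁ a b c r) := by
  have h := (summable_norm_gaussCoeff_mul_pow ha hb hc hr).of_norm.hasSum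
  have e : ₂F₁ a b c r = ∑' n, gaussCoeff a b c n * r ^ n :=
    tsum_congr fun n => (gaussCoeff_mul_pow a b c r n).symm
  rwa [e]

/-! ### Positivity and absolute bounds -/

theorem conj_pochhammerSymbol (a : ℂ) (n : ℕ) :
    starRingEnd ℂ (pochhammerSymbol a n) = pochhammerSymbol (starRingEnd ℂ a) n := by
  induction n with
  | zero => simp [pochhammerSymbol_zero]
  | succ n ih => simp [pochhammerSymbol_succ, ih]

theorem conj_risingBinomial (a : ℂ) (n : ℕ) :
    starRingEnd ℂ (risingBinomial a n) = risingBinomial (starRingEnd ℂ a) n := by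
  simp [risingBinomial, conj_pochhammerSymbol]

theorem conj_hahnSum (α s : ℝ) (j : ℕ) (u p : ℂ) :
    starRingEnd ℂ (hahnSum α s j u p) =
      hahnSum α s j (starRingEnd ℂ u) (starRingEnd ℂ p) := by
  simp [hahnSum, hahnCoeff, conj_pochhammerSymbol]

theorem pochhammerSymbol_ofReal (a : ℝ) (n : ℕ) :
    pochhammerSymbol a n = ((ascPochhammer ℝ n).eval a : ℝ) := by
  induction n with
  | zero => simp [pochhammerSymbol_zero]
  | succ n ih => rw [pochhammerSymbol_succ, ih, ascPochhammer_succ_eval]; push_cast; rfl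

theorem exists_pos_hahnNorm_eq {α β : ℝ} (hα : 0 < α) (hβ : 0 < β) {N j : ℕ} (hj : j ≤ N) :
    ∃ e : ℝ, 0 < e ∧ hahnNorm α β N j = e := by
  have h1 : 0 < (N.descFactorial j : ℝ) := by
    rw [Nat.cast_pos, Nat.pos_iff_ne_zero, Ne, Nat.descFactorial_eq_zero_iff_lt]; omega
  have h2 := ascPochhammer_pos j α hα
  have h3 := ascPochhammer_pos j β hβ
  have h4 := ascPochhammer_pos j (α + β + j) (by positivity)
  have h5 := ascPochhammer_pos N (α + β + j) (by positivity)
  have h6 : 0 < (ascPochhammer ℝ j).eval (j + (α + β) - 1) := by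
    rcases j with _ | n
    · simp
    · apply ascPochhammer_pos
      push_cast
      have : (0 : ℝ) ≤ n := n.cast_nonneg
      linarith
  refine ⟨(ascPochhammer ℝ N).eval (α + β + j) / (N.factorial : ℝ) * (ascPochhammer ℝ j).eval β *
    (j.factorial : ℝ) * (ascPochhammer ℝ j).eval (j + (α + β) - 1) /
      ((ascPochhammer ℝ j).eval (α + β + j) * (ascPochhammer ℝ j).eval α *
        (N.descFactorial j : ℝ)), by positivity, ?_⟩
  rw [hahnNorm]
  push_cast
  simp only [← pochhammerSymbol_ofReal]
  push_cast
  rfl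

/-- The coefficients of the product `₂F₁(u, v; α; r) ₂F₁(u', v'; β; r)`. -/
noncomputable def gaussConvolution (u v α u' v' β : ℂ) (N : ℕ) : ℂ :=
  ∑ k ∈ range (N + 1), gaussCoeff u v α k * gaussCoeff u' v' β (N - k)

/-- The `j`-th term of the bilinear sum at degree `N` in `r`. -/
noncomputable def bilinearTerm (α β p q u v : ℂ) (N j : ℕ) : ℂ :=
  risingBinomial p N * risingBinomial q N / hahnNorm α β N j *
    (hahnSum α (α + β) j u p * hahnSum α (α + β) j v q)

theorem sum_bilinearTerm {α β : ℂ} (hα : 0 < α.re) (hβ : 0 < β.re)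
    {p q : ℂ} (hp : 0 < p.re) (hq : 0 < q.re) (u v : ℂ) (N : ℕ) :
    ∑ j ∈ range (N + 1), bilinearTerm α β p q u v N j =
      gaussConvolution u v α (p - u) (q - v) β N :=
  sum_hahnSum_mul_hahnSum_div_hahnNorm hα hβ hp hq u v N

/-- This is the diagonal case `v = conj u`, `q = conj p` of `sum_bilinearTerm`: as `α` and `β` are
real, each term is a squared modulus over the norm. -/
theorem sum_norm_sq_div_le {α β : ℝ} (hα : 0 < α) (hβ : 0 < β) {p : ℂ} (hp : 0 < p.re) (u : ℂ)
    (N : ℕ) (e : ℕ → ℝ) (he : ∀ j ≤ N, hahnNorm α β N j = e j) :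
    ∑ j ∈ range (N + 1), ‖risingBinomial p N * hahnSum α (α + β) j u p‖ ^ 2 / e j ≤
      ‖gaussConvolution u (starRingEnd ℂ u) α (p - u) (starRingEnd ℂ (p - u)) β N‖ := by
  rw [map_sub, ← sum_bilinearTerm (by simpa using hα) (by simpa using hβ) hp (by simpa using hp)]
  refine le_trans (le_abs_self _) ?_
  rw [← Real.norm_eq_abs, ← Complex.norm_real]
  apply le_of_eq
  congr 1
  push_cast
  refine sum_congr rfl fun j hj => ?_
  have h := conj_hahnSum α (α + β) j u p
  push_cast at h
  rw [← he j (mem_range_succ_iff.mp hj), bilinearTerm, ← conj_risingBinomial, ← h,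
    ← Complex.mul_conj', map_mul]
  ring

theorem sum_norm_bilinearTerm_le {α β : ℝ} (hα : 0 < α) (hβ : 0 < β) {p q : ℂ} (hp : 0 < p.re)
    (hq : 0 < q.re) (u v : ℂ) (N : ℕ) :
    ∑ j ∈ range (N + 1), ‖bilinearTerm α β p q u v N j‖ ≤
      ‖gaussConvolution u (starRingEnd ℂ u) α (p - u) (starRingEnd ℂ (p - u)) β N‖ +
      ‖gaussConvolution v (starRingEnd ℂ v) α (q - v) (starRingEnd ℂ (q - v)) β N‖ := by
  have hex : ∀ j, ∃ e : ℝ, j ≤ N → 0 < e ∧ hahnNorm α β N j = e := by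
    intro j
    by_cases hj : j ≤ N
    · obtain ⟨e, he⟩ := exists_pos_hahnNorm_eq hα hβ hj
      exact ⟨e, fun _ => he⟩
    -- The value beyond `N` is arbitrary; such indices never enter the sums.
    · exact ⟨0, fun h => absurd h hj⟩
  choose e he using hex
  refine le_trans ?_ (add_le_add
    (sum_norm_sq_div_le hα hβ hp u N e fun j hj => (he j hj).2)
    (sum_norm_sq_div_le hα hβ hq v N e fun j hj => (he j hj).2))
  rw [← sum_add_distrib]
  refine sum_le_sum fun j hj => ?_
  obtain ⟨hpos, hnorm⟩ := he j (mem_range_succ_iff.mp hj)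
  set x := risingBinomial p N * hahnSum α (α + β) j u p
  set y := risingBinomial q N * hahnSum α (α + β) j v q
  have : bilinearTerm α β p q u v N j = x * y / e j := by
    rw [bilinearTerm, hnorm]; ring
  rw [this, norm_div, norm_mul, Complex.norm_real, Real.norm_of_nonneg hpos.le, ← add_div]
  gcongr
  -- `‖x‖ ‖y‖ ≤ ‖x‖² + ‖y‖²` separates the two variables.
  nlinarith [sq_nonneg (‖x‖ - ‖y‖), norm_nonneg x, norm_nonneg y]

/-! ### Summation over the degree in `r` -/

theorem gaussConvolution_mul_pow (u v α u' v' β r : ℂ) (N : ℕ) :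
    gaussConvolution u v α u' v' β N * r ^ N = ∑ k ∈ range (N + 1),
      gaussCoeff u v α k * r ^ k * (gaussCoeff u' v' β (N - k) * r ^ (N - k)) := by
  rw [gaussConvolution, sum_mul]
  refine sum_congr rfl fun k hk => ?_
  rw [← Nat.add_sub_cancel' (mem_range_succ_iff.mp hk), pow_add, Nat.add_sub_cancel_left]
  ring

theorem summable_norm_gaussConvolution_mul_pow {u v α u' v' β r : ℂ} (hu : 0 < u.re)
    (hv : 0 < v.re) (hα : 0 < α.re) (hu' : 0 < u'.re) (hv' : 0 < v'.re) (hβ : 0 < β.re)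
    (hr : ‖r‖ < 1) : Summable fun N => ‖gaussConvolution u v α u' v' β N * r ^ N‖ := by
  simp_rw [gaussConvolution_mul_pow]
  exact summable_norm_sum_mul_range_of_summable_norm
    (f := fun k => gaussCoeff u v α k * r ^ k) (g := fun k => gaussCoeff u' v' β k * r ^ k)
    (summable_norm_gaussCoeff_mul_pow hu hv hα hr)
    (summable_norm_gaussCoeff_mul_pow hu' hv' hβ hr)

theorem hasSum_gaussConvolution_mul_pow {u v α u' v' β r : ℂ} (hu : 0 < u.re)
    (hv : 0 < v.re) (hα : 0 < α.re) (hu' : 0 < u'.re) (hv' : 0 < v'.re) (hβ : 0 < β.re)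
    (hr : ‖r‖ < 1) :
    HasSum (fun N => gaussConvolution u v α u' v' β N * r ^ N) (₂F₁ u v α r * ₂F₁ u' v' β r) := by
  have h := hasSum_sum_range_mul_of_summable_norm
    (summable_norm_gaussCoeff_mul_pow hu hv hα hr)
    (summable_norm_gaussCoeff_mul_pow hu' hv' hβ hr)
  rw [(hasSum_gaussCoeff_mul_pow hu hv hα hr).tsum_eq,
    (hasSum_gaussCoeff_mul_pow hu' hv' hβ hr).tsum_eq] at h
  simpa only [gaussConvolution_mul_pow] using h

/-- Splitting every `(z)_{j+n}` as `(z)_j (z + j)_n` isolates the dependence on `n`, which is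
exactly a Gauss coefficient. -/
theorem bilinearTerm_add {α β : ℂ} (hα : 0 < α.re) (hβ : 0 < β.re) (p q u v : ℂ) (j n : ℕ) :
    bilinearTerm α β p q u v (j + n) j =
      pochhammerSymbol α j * pochhammerSymbol p j * pochhammerSymbol q j /
        ((j.factorial : ℂ) * pochhammerSymbol β j * pochhammerSymbol (j + (α + β) - 1) j) *
      (hahnSum α (α + β) j u p * hahnSum α (α + β) j v q) *
      gaussCoeff (p + j) (q + j) (α + β + 2 * j) n := by
  have hs : 0 < (α + β).re := by simp; positivity
  have hsj : 0 < (α + β + j).re := by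
    simp only [Complex.add_re, Complex.natCast_re]; positivity
  have hsjj : 0 < (α + β + j + j).re := by
    simp only [Complex.add_re, Complex.natCast_re]; positivity
  have h0 : ((n.factorial : ℕ) : ℂ) * ((j + n).descFactorial j : ℂ) = ((j + n).factorial : ℂ) := by
    have := Nat.factorial_mul_descFactorial (Nat.le_add_right j n)
    rw [Nat.add_sub_cancel_left] at this
    exact_mod_cast this
  have h1 : ((j + n).descFactorial j : ℂ) ≠ 0 := by
    rw [Nat.cast_ne_zero, Ne, Nat.descFactorial_eq_zero_iff_lt]; omega
  have h2 := pochhammerSymbol_ne_zero hα j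
  have h3 := pochhammerSymbol_ne_zero hβ j
  have h4 := pochhammerSymbol_ne_zero hsj j
  have h5 := pochhammerSymbol_ne_zero hsjj n
  have h6 := pochhammerSymbol_natCast_add_sub_one_ne_zero hs j
  have h7 : (n.factorial : ℂ) ≠ 0 := mod_cast n.factorial_ne_zero
  have h8 : (j.factorial : ℂ) ≠ 0 := mod_cast j.factorial_ne_zero
  rw [bilinearTerm, hahnNorm, gaussCoeff, show α + β + 2 * (j : ℂ) = α + β + j + j by ring]
  simp only [risingBinomial, pochhammerSymbol_add _ j n, ← h0]
  field_simp

/-- The bilinear sum formula with general parameters. -/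
theorem hasSum_bilinear {α β : ℝ} (hα : 0 < α) (hβ : 0 < β) {p q u v r : ℂ} (hu : 0 < u.re)
    (hv : 0 < v.re) (hpu : 0 < (p - u).re) (hqv : 0 < (q - v).re) (hr : ‖r‖ < 1) :
    HasSum (fun j : ℕ =>
      pochhammerSymbol α j * pochhammerSymbol p j * pochhammerSymbol q j /
        ((j.factorial : ℂ) * pochhammerSymbol β j * pochhammerSymbol (j + (α + β) - 1) j) *
      (hahnSum α (α + β) j u p * hahnSum α (α + β) j v q) *
      ₂F₁ (p + j) (q + j) (α + β + 2 * j : ℂ) r * r ^ j)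
      (₂F₁ u v (α : ℂ) r * ₂F₁ (p - u) (q - v) (β : ℂ) r) := by
  have hα' : 0 < (α : ℂ).re := hα
  have hβ' : 0 < (β : ℂ).re := hβ
  have hp : 0 < p.re := by rw [Complex.sub_re] at hpu; linarith
  have hq : 0 < q.re := by rw [Complex.sub_re] at hqv; linarith
  let T : ℕ × ℕ → ℂ := fun x => bilinearTerm α β p q u v (x.1 + x.2) x.1 * r ^ (x.1 + x.2)
  have hfiber : ∀ (g : ℕ → ℕ → ℂ) (N : ℕ) (x : antidiagonal N),
      g (x.1.1 + x.1.2) x.1.1 = g N x.1.1 := fun g N x => by rw [mem_antidiagonal.mp x.2]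
  -- Group by total degree `N`; the norms in each group are bounded by coefficients of two
  -- absolutely convergent products of Gauss series.
  have hsummable : Summable T := by
    rw [← HasAntidiagonal.sigmaAntidiagonalEquivProd.summable_iff]
    apply Summable.of_norm
    rw [summable_sigma_of_nonneg fun _ => norm_nonneg _]
    refine ⟨fun N => (hasSum_fintype _).summable, ?_⟩
    have hbound := (summable_norm_gaussConvolution_mul_pow hu
      (v := starRingEnd ℂ u) (by simpa using hu) hα' hpu (v' := starRingEnd ℂ (p - u))
      (by rw [Complex.conj_re]; exact hpu) hβ' hr).add
      (summable_norm_gaussConvolution_mul_pow hv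
      (v := starRingEnd ℂ v) (by simpa using hv) hα' hqv (v' := starRingEnd ℂ (q - v))
      (by rw [Complex.conj_re]; exact hqv) hβ' hr)
    refine Summable.of_nonneg_of_le (fun N => tsum_nonneg fun _ => norm_nonneg _) (fun N => ?_)
      hbound
    rw [tsum_fintype]
    have : ∀ x : antidiagonal N,
        ‖(T ∘ HasAntidiagonal.sigmaAntidiagonalEquivProd) (⟨N, x⟩ : Σ n, antidiagonal n)‖ =
          ‖bilinearTerm α β p q u v N x.1.1‖ * ‖r ^ N‖ := fun x => by
      rw [← norm_mul]
      exact congrArg norm (hfiber (fun N j => bilinearTerm α β p q u v N j * r ^ N) N x)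
    simp_rw [this]
    rw [sum_coe_sort (antidiagonal N) (fun x : ℕ × ℕ => ‖bilinearTerm α β p q u v N x.1‖ * ‖r ^ N‖),
      Finset.Nat.sum_antidiagonal_eq_sum_range_succ
      fun j _ => ‖bilinearTerm α β p q u v N j‖ * ‖r ^ N‖, ← sum_mul, norm_mul, norm_mul, ← add_mul]
    gcongr
    exact sum_norm_bilinearTerm_le hα hβ hp hq u v N
  have htotal : HasSum T (₂F₁ u v (α : ℂ) r * ₂F₁ (p - u) (q - v) (β : ℂ) r) := by
    have h1 := (HasAntidiagonal.sigmaAntidiagonalEquivProd.hasSum_iff).mpr hsummable.hasSum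
    have h2 := h1.sigma fun N => hasSum_fintype _
    have h3 := hasSum_gaussConvolution_mul_pow hu hv hα' hpu hqv hβ' hr
    convert hsummable.hasSum using 1
    refine h3.unique ?_
    convert h2 using 2 with N
    have : ∀ x : antidiagonal N,
        (T ∘ HasAntidiagonal.sigmaAntidiagonalEquivProd) (⟨N, x⟩ : Σ n, antidiagonal n) =
          bilinearTerm α β p q u v N x.1.1 * r ^ N := fun x =>
      hfiber (fun N j => bilinearTerm α β p q u v N j * r ^ N) N x
    simp_rw [this]
    rw [sum_coe_sort (antidiagonal N) (fun x : ℕ × ℕ => bilinearTerm α β p q u v N x.1 * r ^ N),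
      Finset.Nat.sum_antidiagonal_eq_sum_range_succ
      fun j _ => bilinearTerm α β p q u v N j * r ^ N, ← sum_mul, sum_bilinearTerm hα' hβ' hp hq]
  -- Regroup the same double series by `j`, summing over `n = N - j`.
  refine htotal.prod_fiberwise fun j => ?_
  have hG := hasSum_gaussCoeff_mul_pow (a := p + j) (b := q + j) (c := α + β + 2 * j) (r := r)
    (by simp only [Complex.add_re, Complex.natCast_re]; positivity)
    (by simp only [Complex.add_re, Complex.natCast_re]; positivity)
    (by simp; positivity) hr
  have hmul := (hG.mul_left (pochhammerSymbol α j * pochhammerSymbol p j * pochhammerSymbol q j /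
        ((j.factorial : ℂ) * pochhammerSymbol β j * pochhammerSymbol (j + (α + β) - 1) j) *
      (hahnSum α (α + β) j u p * hahnSum α (α + β) j v q))).mul_right (r ^ j)
  refine hmul.congr_fun ?_
  intro n
  simp only [T]
  rw [bilinearTerm_add hα' hβ', pow_add]
  ring

/-! ### Specialization to continuous Hahn polynomials -/

theorem continuousHahn_eq_hahnSum (j : ℕ) (x a b d : ℂ) :
    continuousHahn j x a b a d =
      Complex.I ^ j * (pochhammerSymbol (2 * a) j * pochhammerSymbol (a + d) j /
        (j.factorial : ℂ)) * hahnSum (2 * a) (2 * a + (b + d)) j (a + Complex.I * x) (a + d) := by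
  rw [continuousHahn, hypergeometric₃F₂, tsum_eq_sum (s := range (j + 1)), hahnSum, ← two_mul]
  · congr 1
    refine sum_congr rfl fun i _ => ?_
    have : (j : ℂ) + a + b + a + d - 1 = j + (2 * a + (b + d)) - 1 := by ring
    rw [this, hahnCoeff, one_pow, mul_one, div_mul_div_comm]
    congr 1
    ring
  · intro i hi
    rw [mem_range, not_lt] at hi
    rw [pochhammerSymbol_neg_natCast, Nat.descFactorial_of_lt (by omega)]
    simp

theorem mainTheorem1 (a : ℝ) (b d b' d' r : ℂ) (x y : ℝ)
    (ha : 0 < a) (hb : 0 < b.re) (hd : 0 < d.re) (hb' : 0 < b'.re) (hd' : 0 < d'.re)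
    (hsum : b + d = b' + d')
    (hconj : starRingEnd ℂ d = b) (hconj' : starRingEnd ℂ d' = b')
    (hr : ‖r‖ < 1) :
    HasSum
      (fun j : ℕ =>
        bilinearHahnCoeff (a : ℂ) b d d' r j *
          continuousHahn j (x : ℂ) (a : ℂ) b (a : ℂ) d *
          continuousHahn j (y : ℂ) (a : ℂ) b' (a : ℂ) d' * r ^ j)
      (₂F₁ ((a : ℂ) + Complex.I * (x : ℂ)) ((a : ℂ) + Complex.I * (y : ℂ)) (2 * (a : ℂ)) r *
        ₂F₁ (d - Complex.I * (x : ℂ)) (d' - Complex.I * (y : ℂ)) (b + d) r) := by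
  -- Conjugacy of `b` and `d` makes `β` real, as the positivity argument requires.
  have hβ : b + d = ((2 * d.re : ℝ) : ℂ) := by
    rw [← hconj, add_comm, Complex.add_conj]
  have hα : 2 * (a : ℂ) = ((2 * a : ℝ) : ℂ) := by push_cast; rfl
  have hα0 : 0 < 2 * a := by positivity
  have hβ0 : 0 < 2 * d.re := by positivity
  have hu : ∀ z : ℝ, 0 < ((a : ℂ) + Complex.I * z).re := fun z => by simpa using ha
  have hpu : ∀ (e : ℂ) (z : ℝ),
      (a : ℂ) + e - ((a : ℂ) + Complex.I * z) = e - Complex.I * z := fun e z => by ring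
  have key := hasSum_bilinear (p := a + d) (q := a + d') hα0 hβ0 (hu x) (hu y)
    (by rw [hpu]; simpa using hd) (by rw [hpu]; simpa using hd') hr
  rw [hpu, hpu, ← hα, ← hβ] at key
  refine key.congr_fun ?_
  intro j
  rw [continuousHahn_eq_hahnSum, continuousHahn_eq_hahnSum, ← hsum, bilinearHahnCoeff]
  have hs : 2 * (a : ℂ) + b + d + j - 1 = j + (2 * a + (b + d)) - 1 := by ring
  -- The two factors `i^j` cancel the sign in `h_j`.
  have hI : Complex.I ^ j * Complex.I ^ j * (-1) ^ j = 1 := by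
    rw [← mul_pow, ← mul_pow]; simp
  have h1 : pochhammerSymbol (2 * (a : ℂ)) j ≠ 0 :=
    pochhammerSymbol_ne_zero (by simpa using ha) j
  have h2 : (j.factorial : ℂ) ≠ 0 := mod_cast j.factorial_ne_zero
  rw [hs, add_assoc (2 * (a : ℂ)) b d]
  generalize Complex.I ^ j = z at hI ⊢
  generalize pochhammerSymbol (j + (2 * (a : ℂ) + (b + d)) - 1) j = w
  generalize ₂F₁ (_ : ℂ) _ _ r = F
  generalize hahnSum _ _ j _ _ = R
  generalize hahnSum _ _ j _ _ = S
  field_simp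
  linear_combination (F * pochhammerSymbol (a + d) j * R * pochhammerSymbol (a + d') j * S *
    r ^ j / (pochhammerSymbol (b + d) j * w)) * hI
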